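/- Let $\mathcal E$ be a Euclidean space (finite-dimensional real Hilbert space) and let $\mathcal M\subseteq\mathcal E$ be an embedded submanifold: every $\bar x\in\mathcal M$ has an open neighborhood $U\subseteq\mathcal E$ such that $\mathcal M\cap U=\{x\in U: F(x)=0\}$ for some $\mathcal C^1$ map $F:U\to\mathbb R^m$ whose derivative at $\bar x$ has rank $m$. For $x\in\mathcal M$ let $T_x\mathcal M\subseteq\mathcal E$ be the set of velocities $\dot\gamma(0)$ of $\mathcal C^1$ curves $\gamma:I\to\mathcal M$ on open intervals $I\ni 0$ with $\gamma(0)=x$, equipped with the inner product of $\mathcal E$, and let $T\mathcal M=\{(x,\xi): x\in\mathcal M,\ \xi\in T_x\mathcal M\}$. Let $\mathrm R:T\mathcal M\to\mathcal M$, $\mathrm R_x:=\mathrm R(x,\cdot)$, be a retraction: $\mathrm R$ is of class $\mathcal C^2$ (around each point of $T\mathcal M$ it extends to a $\mathcal C^2$ map on an open subset of $\mathcal E\times\mathcal E$), and $\mathrm R_x(0)=x$ and $D\mathrm R_x(0)=\mathrm{id}_{T_x\mathcal M}$ for all $x\in\mathcal M$. Let $\mathcal O\subseteq\mathcal E$ be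 open with $\mathcal M\subseteq\mathcal O$ and let $\varphi$ be a real-valued function that is upper-$\mathcal C^2$ on $\mathcal O$: each point of $\mathcal O$ has an open neighborhood $V\subseteq\mathcal O$ on which $\varphi(x)=\min_{c\in C}\varphi_c(x)$, where $C$ is a compact topological space, each $\varphi_c$ is of class $\mathcal C^2$ on $V$, and $\varphi_c(x)$ and its first and second derivatives in $x$ depend continuously on $(x,c)\in V\times C$. For $g:\mathcal E\to(-\infty,\infty]$ and $x$ with $g(x)<\infty$ let $$\hat\partial g(x)=\Big\{v\in\mathcal E:\ \liminf_{y\to x,\,y\ne x}\frac{g(y)-g(x)-\langle v,y-x\rangle}{\|y-x\|}\ge 0\Big\}$$ be the Fréchet subdifferential (empty where $g=\infty$), and let $\partial g(x)$ be the limiting subdifferential, i.e. the set of all $v$ for which there are $x^k\to x$ with $g(x^k)\to g(x)$ and $v^k\in\hat\partial g(x^k)$ with $v^k\to v$. For $x\in\mathcal M$ let $\partial_{\mathcal M}\varphi(x)=\mathrm{proj}_{T_x\mathcal M}\,\partial(\varphi+\delta_{\mathcal M})(x)$ be the projectional subdifferential, where $\delta_{\mathcal M}$ is $0$ on $\mathcal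 M$ and $\infty$ elsewhere. Then: 1. For every $\bar x\in\mathcal M$ there are constants $\tilde\kappa>0$, $r>0$ and an open neighborhood $V\subseteq\mathcal M$ of $\bar x$ such that $$\varphi\big(\mathrm R_x(\xi)\big)-\big(\varphi(x)+\langle w_{\mathcal M},\xi\rangle\big)\le\tilde\kappa\|\xi\|^2$$ for all $x\in V$, all $\xi\in T_x\mathcal M$ with $\|\xi\|\le r$, and all $w_{\mathcal M}\in\partial_{\mathcal M}\varphi(x)$. 2. $\partial_{\mathcal M}\varphi$ is locally bounded: for every $\bar x\in\mathcal M$ there are $G\in\mathbb R$ and an open neighborhood $V\subseteq\mathcal M$ of $\bar x$ such that $\|w\|\le G$ for all $x\in V$ and all $w\in\partial_{\mathcal M}\varphi(x)$. -/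

import Mathlib

open Filter Topology Set

universe u v

noncomputable section

/-- `M` is an embedded `C^1` submanifold of dimension `d` of the Euclidean space `E` around `x`:
near `x` it is the zero set of a `C^1` map `F` into `ℝ^m`, `m + d = dim E`, whose derivative at `x`
has full rank `m`. -/
def IsEmbeddedSubmanifoldAround {E : Type*} [NormedAddCommGroup E] [InnerProductSpace ℝ E]
    (M : Set E) (d : ℕ) (x : E) : Prop :=
  ∃ U : Set E, IsOpen U ∧ x ∈ U ∧
    ∃ m : ℕ, m + d = Module.finrank ℝ E ∧
      ∃ F : E → EuclideanSpace ℝ (Fin m),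
        ContDiffOn ℝ 1 F U ∧
        Module.finrank ℝ (LinearMap.range (fderiv ℝ F x).toLinearMap) = m ∧
        M ∩ U = {y | y ∈ U ∧ F y = 0}

/-- `M` is an embedded submanifold of `E` (its dimension may differ between components). -/
def IsEmbeddedSubmanifold {E : Type*} [NormedAddCommGroup E] [InnerProductSpace ℝ E]
    (M : Set E) : Prop :=
  ∀ x ∈ M, ∃ d : ℕ, IsEmbeddedSubmanifoldAround M d x

/-- The tangent space `T_x M`: the velocities at time `0` of the `C^1` curves in `M` that pass
through `x` at time `0`. -/
def embTangentSpace {E : Type*} [NormedAddCommGroup E] [InnerProductSpace ℝ E]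
    (M : Set E) (x : E) : Set E :=
  {v | ∃ (ε : ℝ) (γ : ℝ → E), 0 < ε ∧ ContDiffOn ℝ 1 γ (Ioo (-ε) ε) ∧
    (∀ t ∈ Ioo (-ε) ε, γ t ∈ M) ∧ γ 0 = x ∧ deriv γ 0 = v}

/-- The tangent bundle of `M`, as a subset of `E × E`. -/
def embTangentBundle {E : Type*} [NormedAddCommGroup E] [InnerProductSpace ℝ E]
    (M : Set E) : Set (E × E) :=
  {p | p.1 ∈ M ∧ p.2 ∈ embTangentSpace M p.1}

/-- `R` is a (globally defined) `C^2` retraction on `M`. Only the values of `R` on the tangent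
bundle matter. Being `C^2` on the tangent bundle means having, around each of its points, a `C^2`
extension to an open subset of `E × E`. -/
structure IsRetraction {E : Type*} [NormedAddCommGroup E] [InnerProductSpace ℝ E]
    (M : Set E) (R : E → E → E) : Prop where
  mapsTo : ∀ x ∈ M, ∀ ξ ∈ embTangentSpace M x, R x ξ ∈ M
  contDiff : ∀ p ∈ embTangentBundle M, ∃ (W : Set (E × E)) (S : E × E → E),
    IsOpen W ∧ p ∈ W ∧ ContDiffOn ℝ 2 S W ∧
      ∀ q ∈ W ∩ embTangentBundle M, S q = R q.1 q.2
  map_zero : ∀ x ∈ M, R x 0 = x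
  deriv_zero : ∀ x ∈ M,
    HasFDerivWithinAt (R x) (ContinuousLinearMap.id ℝ E) (embTangentSpace M x) 0

/-- The Fréchet (regular) subdifferential of an extended-valued function at a point of its
domain; it is empty at points where the function is not finite. -/
def frechetSubdifferential {E : Type*} [NormedAddCommGroup E] [InnerProductSpace ℝ E]
    (g : E → EReal) (x : E) : Set E :=
  {v | g x ≠ ⊤ ∧ g x ≠ ⊥ ∧
    0 ≤ liminf (fun y : E =>
      (g y - g x - ((inner ℝ v (y - x) : ℝ) : EReal)) / ((‖y - x‖ : ℝ) : EReal)) (𝓝[≠] x)}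

/-- The limiting (Mordukhovich, basic) subdifferential. -/
def limitingSubdifferential {E : Type*} [NormedAddCommGroup E] [InnerProductSpace ℝ E]
    (g : E → EReal) (x : E) : Set E :=
  {v | g x ≠ ⊤ ∧ g x ≠ ⊥ ∧ ∃ (u w : ℕ → E),
    Tendsto u atTop (𝓝 x) ∧ Tendsto (fun k => g (u k)) atTop (𝓝 (g x)) ∧
    (∀ k, w k ∈ frechetSubdifferential g (u k)) ∧ Tendsto w atTop (𝓝 v)}

open Classical in
/-- The indicator function of `S` in the sense of variational analysis: `0` on `S`, `∞` off `S`. -/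
def indicatorTop {E : Type*} (S : Set E) (x : E) : EReal :=
  if x ∈ S then 0 else ⊤

/-- The image of the set `A` under the (metric, set-valued) projection onto `S`. -/
def metricProj {E : Type*} [NormedAddCommGroup E] (S A : Set E) : Set E :=
  {y | y ∈ S ∧ ∃ v ∈ A, ‖v - y‖ = Metric.infDist v S}

/-- The projectional limiting subdifferential of `g` relative to `M`: the projection onto `T_x M`
of the limiting subdifferential of `g + δ_M` at `x`. -/
def projSubdifferential {E : Type*} [NormedAddCommGroup E] [InnerProductSpace ℝ E]
    (M : Set E) (g : E → EReal) (x : E) : Set E :=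
  metricProj (embTangentSpace M x) (limitingSubdifferential (fun y => g y + indicatorTop M y) x)

/-- `φ` is upper-`C^2` on the open set `O`: near each point of `O` it is a (pointwise attained)
minimum of `C^2` functions `Φ c`, where `c` ranges over a compact space and `Φ c y` and its first
and second derivatives in `y` depend continuously on `(y, c)`. -/
def IsUpperC2On {E : Type u} [NormedAddCommGroup E] [InnerProductSpace ℝ E]
    (φ : E → ℝ) (O : Set E) : Prop :=
  ∀ x ∈ O, ∃ V : Set E, IsOpen V ∧ x ∈ V ∧ V ⊆ O ∧
    ∃ (C : Type v) (_ : TopologicalSpace C) (_ : CompactSpace C) (Φ : C → E → ℝ),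
      (∀ y ∈ V, IsLeast (range fun c => Φ c y) (φ y)) ∧
      (∀ c, ContDiffOn ℝ 2 (Φ c) V) ∧
      ContinuousOn (fun p : E × C => Φ p.2 p.1) (V ×ˢ univ) ∧
      ContinuousOn (fun p : E × C => fderiv ℝ (Φ p.2) p.1) (V ×ˢ univ) ∧
      ContinuousOn (fun p : E × C => fderiv ℝ (fderiv ℝ (Φ p.2)) p.1) (V ×ˢ univ)

end

/-! Near a given point, take a function `Φ c` that is active at `y`. It touches `φ` at `y` and
majorizes it nearby, so Taylor's formula and compactness of `C` give `φ z ≤ φ y + ℓ (z - y) + κ‖z -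
y‖²` with `κ` and the bound on `ℓ` independent of `y` (`IsUpperC2On.exists_quadratic_upper_model`).

A Fréchet subgradient `v` of `φ + δ_M` at `u` minorizes `φ` on `M` to first order. Comparing the two
models along curves in `M` gives `⟨v, η⟩ ≤ ℓ η` for tangent `η`, and equality because the tangent
space is symmetric (`inner_eq_of_mem_frechetSubdifferential`). As `R u η = u + η + O(‖η‖²)`
uniformly, inserting `z = R u η` in the upper model proves the estimate for Fréchet subgradients.

For a projected limiting subgradient `w`, tangent spaces vary continuously enough to write a tangent
`ξ` as a limit of tangent `η k` at nearby `u k`, with `⟨v k, η k⟩ → ⟨w, ξ⟩`. The uniform estimates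
survive the limit by continuity of `φ` and `R`. Taking `ξ = w` gives `‖w‖² ≤ L‖w‖`, hence local
boundedness. -/

/-! ### Quadratic upper models and continuity of upper-`C^2` functions. -/

/-- A quantitative first-order Taylor estimate for maps with Lipschitz derivative. -/
lemma norm_taylor_le_of_lipschitz_fderiv {E F : Type*} [NormedAddCommGroup E] [NormedSpace ℝ E]
    [NormedAddCommGroup F] [NormedSpace ℝ F] {f : E → F} {f' : E → E →L[ℝ] F} {s : Set E}
    {K : ℝ} (hK : 0 ≤ K) (hs : Convex ℝ s) (hf : ∀ x ∈ s, HasFDerivAt f (f' x) x)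
    (hL : ∀ x ∈ s, ∀ y ∈ s, ‖f' x - f' y‖ ≤ K * ‖x - y‖) {y z : E} (hy : y ∈ s) (hz : z ∈ s) :
    ‖f z - f y - f' y (z - y)‖ ≤ K * ‖z - y‖ ^ 2 := by
  have hsub : segment ℝ y z ⊆ s := hs.segment_subset hy hz
  have h := (convex_segment (𝕜 := ℝ) y z).norm_image_sub_le_of_norm_hasFDerivWithin_le'
    (f := f) (f' := f') (φ := f' y) (C := K * ‖z - y‖)
    (fun x hx => (hf x (hsub hx)).hasFDerivWithinAt)
    (fun x hx => ?_) (left_mem_segment ℝ y z) (right_mem_segment ℝ y z)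
  · rwa [mul_assoc, ← pow_two] at h
  · refine (hL x (hsub hx) y hy).trans ?_
    gcongr
    obtain ⟨t, ⟨ht0, ht1⟩, rfl⟩ := (segment_eq_image' ℝ y z) ▸ hx
    rw [add_sub_cancel_left, norm_smul, Real.norm_of_nonneg ht0]
    exact mul_le_of_le_one_left (norm_nonneg _) ht1

/-- Around each point, an upper-`C^2` function has a uniform quadratic upper model. -/
lemma IsUpperC2On.exists_quadratic_upper_model {E : Type u} [NormedAddCommGroup E]
    [InnerProductSpace ℝ E] [FiniteDimensional ℝ E] {φ : E → ℝ} {O : Set E}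
    (hφ : IsUpperC2On.{u, v} φ O) {x : E} (hx : x ∈ O) :
    ∃ κ L ε : ℝ, 0 ≤ κ ∧ 0 ≤ L ∧ 0 < ε ∧ ∀ y ∈ Metric.ball x ε, ∃ ℓ : E →L[ℝ] ℝ, ‖ℓ‖ ≤ L ∧
      ∀ z ∈ Metric.ball x ε, φ z ≤ φ y + ℓ (z - y) + κ * ‖z - y‖ ^ 2 := by
  obtain ⟨V, hV, hxV, -, C, _, _, Φ, hmin, hΦ, -, hd1, hd2⟩ := hφ x hx
  obtain ⟨ε, hε, hεV⟩ := Metric.nhds_basis_closedBall.mem_iff.1 (hV.mem_nhds hxV)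
  have hcomp : IsCompact (Metric.closedBall x ε ×ˢ (univ : Set C)) :=
    (isCompact_closedBall x ε).prod isCompact_univ
  have hsub : Metric.closedBall x ε ×ˢ (univ : Set C) ⊆ V ×ˢ univ := prod_mono hεV subset_rfl
  obtain ⟨L, hL⟩ := hcomp.exists_bound_of_continuousOn (hd1.mono hsub)
  obtain ⟨κ, hκ⟩ := hcomp.exists_bound_of_continuousOn (E := E →L[ℝ] E →L[ℝ] ℝ)
    (f := fun p : E × C => fderiv ℝ (fderiv ℝ (Φ p.2)) p.1) (hd2.mono hsub)
  refine ⟨max κ 0, max L 0, ε, le_max_right _ _, le_max_right _ _, hε, fun y hy => ?_⟩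
  have hball : Metric.ball x ε ⊆ V := Metric.ball_subset_closedBall.trans hεV
  obtain ⟨c, hc⟩ := (hmin y (hball hy)).1
  refine ⟨fderiv ℝ (Φ c) y,
    (hL (y, c) ⟨Metric.ball_subset_closedBall hy, trivial⟩).trans (le_max_left _ _),
    fun z hz => ?_⟩
  have hCD : ∀ w ∈ Metric.ball x ε, ContDiffAt ℝ 2 (Φ c) w := fun w hw =>
    (hΦ c).contDiffAt (hV.mem_nhds (hball hw))
  have key := norm_taylor_le_of_lipschitz_fderiv (f := Φ c) (f' := fderiv ℝ (Φ c))
    (le_max_right κ 0) (convex_ball x ε)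
    (fun w hw => ((hCD w hw).differentiableAt (by norm_num)).hasFDerivAt)
    (fun w hw w' hw' => (convex_ball x ε).norm_image_sub_le_of_norm_fderiv_le (𝕜 := ℝ)
      (fun w hw => ((hCD w hw).fderiv_right (m := 1) (by norm_num)).differentiableAt (by norm_num))
      (fun w hw => (hκ (w, c) ⟨Metric.ball_subset_closedBall hw, trivial⟩).trans
        (le_max_left _ _)) hw' hw) hy hz
  have hzc : φ z ≤ Φ c z := (hmin z (hball hz)).2 ⟨c, rfl⟩
  have hle := (Real.le_norm_self _).trans key
  simp only at hc
  linarith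

/-- Upper-`C^2` functions on an open set are continuous there. -/
lemma IsUpperC2On.continuousAt {E : Type u} [NormedAddCommGroup E]
    [InnerProductSpace ℝ E] [FiniteDimensional ℝ E] {φ : E → ℝ} {O : Set E}
    (hφ : IsUpperC2On.{u, v} φ O) {x : E} (hx : x ∈ O) : ContinuousAt φ x := by
  obtain ⟨κ, L, ε, hκ, hL, hε, h⟩ := hφ.exists_quadratic_upper_model hx
  have hup : ∀ y ∈ Metric.ball x ε, ∀ z ∈ Metric.ball x ε,
      φ z - φ y ≤ L * ‖z - y‖ + κ * ‖z - y‖ ^ 2 := by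
    intro y hy z hz
    obtain ⟨ℓ, hℓ, hq⟩ := h y hy
    have h1 := hq z hz
    have h2 : ℓ (z - y) ≤ L * ‖z - y‖ := (Real.le_norm_self _).trans (ℓ.le_of_opNorm_le hℓ _)
    linarith
  have hlim : Tendsto (fun z => L * ‖z - x‖ + κ * ‖z - x‖ ^ 2) (𝓝 x) (𝓝 0) := by
    have : Continuous fun z => L * ‖z - x‖ + κ * ‖z - x‖ ^ 2 := by fun_prop
    simpa using this.tendsto x
  refine tendsto_iff_norm_sub_tendsto_zero.2
    (squeeze_zero' (.of_forall fun _ => norm_nonneg _) ?_ hlim)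
  filter_upwards [Metric.ball_mem_nhds x hε] with z hz
  have hx' := Metric.mem_ball_self (x := x) hε
  refine abs_le.2 ⟨?_, hup x hx' z hz⟩
  have := hup z hz x hx'
  rw [norm_sub_rev] at this
  linarith

/-! ### Tangent spaces as kernels, and their semicontinuity. -/

/-- A `C^1` map whose derivative at `x` is onto admits, for each kernel direction, a `C^1` curve in
its level set with that velocity. -/
lemma exists_curve_of_mem_ker {E F : Type*} [NormedAddCommGroup E] [NormedSpace ℝ E]
    [FiniteDimensional ℝ E] [NormedAddCommGroup F] [NormedSpace ℝ F] [FiniteDimensional ℝ F]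
    {f : E → F} {x ξ : E} (hf : ContDiffAt ℝ 1 f x) (hx : f x = 0)
    (hsurj : Function.Surjective (fderiv ℝ f x)) (hξ : fderiv ℝ f x ξ = 0) :
    ∃ γ : ℝ → E, ContDiffAt ℝ 1 γ 0 ∧ γ 0 = x ∧ HasDerivAt γ ξ 0 ∧ ∀ᶠ t in 𝓝 0, f (γ t) = 0 := by
  obtain ⟨A₀, hA₀⟩ := (fderiv ℝ f x).toLinearMap.exists_rightInverse_of_surjective
    (LinearMap.range_eq_top.2 hsurj)
  set D := fderiv ℝ f x with hD
  have hA : ∀ w, D (A₀.toContinuousLinearMap w) = w := fun w => LinearMap.congr_fun hA₀ w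
  generalize A₀.toContinuousLinearMap = A at hA
  -- `G` has derivative `id - A D + A D = id` at `x` and satisfies `D ∘ G = f`, so its local inverse
  -- carries the line through `0` along a kernel vector into the zero set of `f`.
  let G : E → E := fun y => (y - x) - A (D (y - x)) + A (f y)
  have hDf : HasFDerivAt f D x := (hf.differentiableAt (by norm_num)).hasFDerivAt
  have hG : ContDiffAt ℝ 1 G x := by fun_prop
  have hG' : HasFDerivAt G (ContinuousLinearEquiv.refl ℝ E : E →L[ℝ] E) x := by
    have h1 : HasFDerivAt (fun y => y - x) (ContinuousLinearMap.id ℝ E) x :=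
      (hasFDerivAt_id x).sub_const x
    have h2 := (h1.sub ((A.comp D).hasFDerivAt.comp x h1)).add (A.hasFDerivAt.comp x hDf)
    have hid : ContinuousLinearMap.id ℝ E - (A.comp D).comp (ContinuousLinearMap.id ℝ E) +
        A.comp D = (ContinuousLinearEquiv.refl ℝ E : E →L[ℝ] E) := by
      ext w
      simp
    rw [hid] at h2
    exact h2
  have hGx : G x = 0 := by simp [G, hx]
  have hDG : ∀ y, D (G y) = f y := fun y => by simp [G, map_sub, map_add, hA]
  let g := hG.localInverse hG' (by norm_num)
  have hg0 : g 0 = x := by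
    have := hG.localInverse_apply_image hG' (by norm_num)
    rwa [hGx] at this
  have hgC : ContDiffAt ℝ 1 g 0 := by
    have := hG.to_localInverse hG' (by norm_num)
    rwa [hGx] at this
  have hst : HasStrictFDerivAt G (ContinuousLinearEquiv.refl ℝ E : E →L[ℝ] E) x :=
    hG.hasStrictFDerivAt' hG' (by norm_num)
  have hgD : HasFDerivAt g (ContinuousLinearEquiv.refl ℝ E : E →L[ℝ] E) 0 := by
    have := hst.to_localInverse.hasFDerivAt
    rw [hGx] at this
    exact this
  have hright : ∀ᶠ y in 𝓝 0, G (g y) = y := by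
    have := hst.eventually_right_inverse
    rw [hGx] at this
    exact this
  have hline : HasDerivAt (fun t : ℝ => t • ξ) ξ 0 := by
    simpa using (hasDerivAt_id (0 : ℝ)).smul_const ξ
  have hlim : Tendsto (fun t : ℝ => t • ξ) (𝓝 0) (𝓝 0) := by
    simpa using hline.continuousAt.tendsto
  refine ⟨fun t => g (t • ξ), ?_, by simp [hg0], ?_, ?_⟩
  · have hgC' : ContDiffAt ℝ 1 g ((0 : ℝ) • ξ) := by rwa [zero_smul]
    exact hgC'.comp (0 : ℝ) (by fun_prop)
  · have hgD' : HasFDerivAt g (ContinuousLinearEquiv.refl ℝ E : E →L[ℝ] E) ((0 : ℝ) • ξ) := by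
      rwa [zero_smul]
    simpa [Function.comp_def] using hgD'.comp_hasDerivAt (0 : ℝ) hline
  · filter_upwards [hlim.eventually hright] with t ht
    rw [← hDG, ht, map_smul, hξ, smul_zero]

/-- Kernels of a continuous family of linear maps depend inner semicontinuously on the parameter
where the map is onto, and surjectivity persists nearby. -/
lemma exists_continuousAt_mem_ker {X E F : Type*} [TopologicalSpace X] [NormedAddCommGroup E]
    [NormedSpace ℝ E] [NormedAddCommGroup F] [NormedSpace ℝ F] [FiniteDimensional ℝ F]
    {D : X → E →L[ℝ] F} {x : X} (hD : ContinuousAt D x) (hsurj : Function.Surjective (D x)) :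
    (∀ᶠ u in 𝓝 x, Function.Surjective (D u)) ∧
    ∀ ξ, D x ξ = 0 → ∃ P : X → E, ContinuousAt P x ∧ P x = ξ ∧ ∀ᶠ u in 𝓝 x, D u (P u) = 0 := by
  have : CompleteSpace F := FiniteDimensional.complete ℝ F
  obtain ⟨A₀, hA₀⟩ := (D x).toLinearMap.exists_rightInverse_of_surjective
    (LinearMap.range_eq_top.2 hsurj)
  have hA : ∀ w, D x (A₀.toContinuousLinearMap w) = w := fun w => LinearMap.congr_fun hA₀ w
  generalize A₀.toContinuousLinearMap = A at hA
  -- `B u` is the identity at `x`, hence invertible nearby, and then `A ∘ (B u)⁻¹` is a right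
  -- inverse of `D u`. Subtracting `A (B u)⁻¹ (D u ξ)` from `ξ` moves it into the kernel.
  let B : X → F →L[ℝ] F := fun u => (D u).comp A
  have hB : ContinuousAt B x := hD.clm_comp continuousAt_const
  have hBx : B x = 1 := by ext w; exact hA w
  have hunit : ∀ᶠ u in 𝓝 x, IsUnit (B u) :=
    hB.eventually (Units.isOpen.mem_nhds (by rw [hBx]; exact isUnit_one))
  have hinv : ∀ᶠ u in 𝓝 x, ∀ w, D u (A (Ring.inverse (B u) w)) = w := by
    filter_upwards [hunit] with u hu w
    exact congrArg (fun T : F →L[ℝ] F => T w) (Ring.mul_inverse_cancel (B u) hu)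
  refine ⟨hinv.mono fun u hu w => ⟨_, hu w⟩, fun ξ hξ => ?_⟩
  have hri : ContinuousAt (fun u => Ring.inverse (B u)) x := by
    have h1 : ContinuousAt (Ring.inverse : (F →L[ℝ] F) → F →L[ℝ] F) (B x) := by
      rw [hBx]
      exact NormedRing.inverse_continuousAt (1 : (F →L[ℝ] F)ˣ)
    exact ContinuousAt.comp (f := B) h1 hB
  refine ⟨fun u => ξ - A (Ring.inverse (B u) (D u ξ)), ?_, by simp [hξ], ?_⟩
  · exact continuousAt_const.sub (A.continuous.continuousAt.comp
      (hri.clm_apply (hD.clm_apply continuousAt_const)))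
  · filter_upwards [hinv] with u hu
    rw [map_sub, hu, sub_self]

/-- Near a point of an embedded submanifold, the tangent spaces are the kernels of a continuous
family of linear maps that is onto at that point. -/
lemma IsEmbeddedSubmanifold.exists_tangentSpace_eq_ker {E : Type*} [NormedAddCommGroup E]
    [InnerProductSpace ℝ E] [FiniteDimensional ℝ E] {M : Set E} (hM : IsEmbeddedSubmanifold M)
    {x : E} (hx : x ∈ M) :
    ∃ (m : ℕ) (D : E → E →L[ℝ] EuclideanSpace ℝ (Fin m)), ContinuousAt D x ∧
      Function.Surjective (D x) ∧
      ∀ᶠ u in 𝓝 x, u ∈ M → ∀ ξ, ξ ∈ embTangentSpace M u ↔ D u ξ = 0 := by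
  obtain ⟨d, U, hU, hxU, m, -, F, hF, hrank, hMU⟩ := hM x hx
  have hsurj : Function.Surjective (fderiv ℝ F x) := by
    refine LinearMap.range_eq_top.1 (Submodule.eq_top_of_finrank_eq ?_)
    rw [hrank, finrank_euclideanSpace_fin]
  have hFC : ∀ u ∈ U, ContDiffAt ℝ 1 F u := fun u hu => hF.contDiffAt (hU.mem_nhds hu)
  have hcont : ContinuousAt (fderiv ℝ F) x := (hFC x hxU).continuousAt_fderiv (by norm_num)
  refine ⟨m, fderiv ℝ F, hcont, hsurj, ?_⟩
  filter_upwards [hU.mem_nhds hxU, (exists_continuousAt_mem_ker hcont hsurj).1]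
    with u huU husurj huM ξ
  have hzero : ∀ y ∈ U, y ∈ M → F y = 0 := fun y hy hyM =>
    (hMU.subset ⟨hyM, hy⟩ : _ ∧ _).2
  constructor
  · rintro ⟨ε, γ, hε, hγ, hγM, rfl, rfl⟩
    have h0 : Ioo (-ε) ε ∈ 𝓝 (0 : ℝ) := Ioo_mem_nhds (by linarith) hε
    have hγd : HasDerivAt γ (deriv γ 0) 0 :=
      ((hγ.contDiffAt h0).differentiableAt (by norm_num)).hasDerivAt
    have hcomp := ((hFC _ huU).differentiableAt (by norm_num)).hasFDerivAt.comp_hasDerivAt 0 hγd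
    refine hcomp.unique (HasDerivAt.congr_of_eventuallyEq
      (hasDerivAt_const (0 : ℝ) (0 : EuclideanSpace ℝ (Fin m))) ?_)
    filter_upwards [h0, hγd.continuousAt (hU.mem_nhds huU)] with t ht htU
    exact hzero _ htU (hγM t ht)
  · intro hξ
    obtain ⟨γ, hγC, hγ0, hγd, hγF⟩ :=
      exists_curve_of_mem_ker (hFC u huU) (hzero u huU huM) husurj hξ
    have hγU : ∀ᶠ t in 𝓝 0, γ t ∈ U :=
      hγd.continuousAt (by rw [hγ0]; exact hU.mem_nhds huU)
    obtain ⟨ε, hε, hball⟩ := Metric.eventually_nhds_iff_ball.1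
      ((hγC.eventually (by norm_num)).and (hγU.and hγF))
    rw [Real.ball_eq_Ioo, zero_sub, zero_add] at hball
    exact ⟨ε, γ, hε, fun t ht => (hball t ht).1.contDiffWithinAt,
      fun t ht => (hMU.superset ⟨(hball t ht).2.1, (hball t ht).2.2⟩).1, hγ0, hγd.deriv⟩

/-- The tangent spaces of an embedded submanifold are linear subspaces. -/
lemma IsEmbeddedSubmanifold.exists_submodule {E : Type*} [NormedAddCommGroup E]
    [InnerProductSpace ℝ E] [FiniteDimensional ℝ E] {M : Set E} (hM : IsEmbeddedSubmanifold M)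
    {x : E} (hx : x ∈ M) : ∃ T : Submodule ℝ E, embTangentSpace M x = T := by
  obtain ⟨m, D, -, -, h⟩ := hM.exists_tangentSpace_eq_ker hx
  exact ⟨LinearMap.ker (D x).toLinearMap, Set.ext fun ξ => h.self_of_nhds hx ξ⟩

/-- The tangent spaces of an embedded submanifold depend inner semicontinuously on the point. -/
lemma IsEmbeddedSubmanifold.exists_continuousAt_tangent {E : Type*} [NormedAddCommGroup E]
    [InnerProductSpace ℝ E] [FiniteDimensional ℝ E] {M : Set E} (hM : IsEmbeddedSubmanifold M)
    {x ξ : E} (hx : x ∈ M) (hξ : ξ ∈ embTangentSpace M x) :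
    ∃ P : E → E, ContinuousAt P x ∧ P x = ξ ∧
      ∀ᶠ u in 𝓝 x, u ∈ M → P u ∈ embTangentSpace M u := by
  obtain ⟨m, D, hD, hsurj, h⟩ := hM.exists_tangentSpace_eq_ker hx
  obtain ⟨P, hP, hPx, hPk⟩ :=
    (exists_continuousAt_mem_ker hD hsurj).2 ξ ((h.self_of_nhds hx ξ).1 hξ)
  refine ⟨P, hP, hPx, ?_⟩
  filter_upwards [h, hPk] with u hu hPu huM
  exact (hu huM _).2 hPu

/-! ### Subgradients against tangent directions. -/

/-- Fréchet subgradients of `φ + δ_M` live at points of `M` and minorize `φ` on `M` to first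
order. -/
lemma frechetSubdifferential_add_indicator {E : Type*} [NormedAddCommGroup E]
    [InnerProductSpace ℝ E] {M : Set E} {φ : E → ℝ} {u v : E}
    (hv : v ∈ frechetSubdifferential (fun y => (φ y : EReal) + indicatorTop M y) u) :
    u ∈ M ∧ ∀ ε > (0 : ℝ), ∀ᶠ z in 𝓝 u, z ∈ M →
      -ε * ‖z - u‖ ≤ φ z - φ u - inner ℝ v (z - u) := by
  obtain ⟨htop, -, hlim⟩ := hv
  have huM : u ∈ M := by
    by_contra h
    simp [indicatorTop, h] at htop
  refine ⟨huM, fun ε hε => ?_⟩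
  have hlt : ((-ε : ℝ) : EReal) < 0 := by exact_mod_cast neg_lt_zero.2 hε
  have hev := eventually_lt_of_lt_liminf (hlt.trans_le hlim)
  rw [eventually_nhdsWithin_iff] at hev
  filter_upwards [hev] with z hz hzM
  rcases eq_or_ne z u with rfl | hne
  · simp
  have h := hz hne
  simp only [indicatorTop, hzM, huM, if_true, add_zero] at h
  rw [← EReal.coe_sub, ← EReal.coe_sub, ← EReal.coe_div, EReal.coe_lt_coe_iff,
    lt_div_iff₀ (norm_pos_iff.2 (sub_ne_zero.2 hne))] at h
  exact h.le

/-- A Fréchet subgradient of `φ + δ_M` agrees on tangent directions with the slope of any quadratic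
upper model of `φ`. -/
lemma inner_eq_of_mem_frechetSubdifferential {E : Type*} [NormedAddCommGroup E]
    [InnerProductSpace ℝ E] [FiniteDimensional ℝ E] {M : Set E} (hM : IsEmbeddedSubmanifold M)
    {φ : E → ℝ} {u v ξ : E} {ℓ : E →L[ℝ] ℝ} {κ : ℝ}
    (hv : v ∈ frechetSubdifferential (fun y => (φ y : EReal) + indicatorTop M y) u)
    (hℓ : ∀ᶠ z in 𝓝 u, φ z ≤ φ u + ℓ (z - u) + κ * ‖z - u‖ ^ 2)
    (hξ : ξ ∈ embTangentSpace M u) : inner ℝ v ξ = ℓ ξ := by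
  obtain ⟨huM, hfre⟩ := frechetSubdifferential_add_indicator hv
  have key : ∀ η ∈ embTangentSpace M u, inner ℝ v η - ℓ η ≤ 0 := by
    rintro η ⟨δ, γ, hδ, hγ, hγM, hγ0, rfl⟩
    have h0 : Ioo (-δ) δ ∈ 𝓝 (0 : ℝ) := Ioo_mem_nhds (by linarith) hδ
    have hγd : HasDerivAt γ (deriv γ 0) 0 :=
      ((hγ.contDiffAt h0).differentiableAt (by norm_num)).hasDerivAt
    set η := deriv γ 0
    have hslope : Tendsto (fun t : ℝ => t⁻¹ • (γ t - u)) (𝓝[>] 0) (𝓝 η) := by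
      have := hγd.tendsto_slope_zero_right
      simpa [hγ0] using this
    have hγu : Tendsto γ (𝓝 0) (𝓝 u) := by simpa [hγ0] using hγd.continuousAt.tendsto
    have hsmall : ∀ ε > (0 : ℝ), inner ℝ v η - ℓ η ≤ ε * ‖η‖ := by
      intro ε hε
      have hl : Tendsto (fun t : ℝ => inner ℝ v (t⁻¹ • (γ t - u)) - ℓ (t⁻¹ • (γ t - u)))
          (𝓝[>] 0) (𝓝 (inner ℝ v η - ℓ η)) :=
        (tendsto_const_nhds.inner hslope).sub ((ℓ.continuous.tendsto η).comp hslope)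
      have hr : Tendsto (fun t : ℝ => ε * ‖t⁻¹ • (γ t - u)‖ +
          κ * (‖t⁻¹ • (γ t - u)‖ * ‖γ t - u‖)) (𝓝[>] 0)
          (𝓝 (ε * ‖η‖ + κ * (‖η‖ * ‖u - u‖))) :=
        (hslope.norm.const_mul ε).add ((hslope.norm.mul
          ((hγu.mono_left nhdsWithin_le_nhds).sub_const u).norm).const_mul κ)
      rw [sub_self, norm_zero, mul_zero, mul_zero, add_zero] at hr
      refine le_of_tendsto_of_tendsto hl hr ?_
      filter_upwards [self_mem_nhdsWithin, nhdsWithin_le_nhds (hγu.eventually (hfre ε hε)),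
        nhdsWithin_le_nhds (hγu.eventually hℓ), nhdsWithin_le_nhds h0] with t ht h1 h2 h3
      have ht' : 0 < t⁻¹ := inv_pos.2 ht
      have h4 := h1 (hγM t h3)
      rw [inner_smul_right, map_smul, norm_smul, Real.norm_of_nonneg ht'.le, smul_eq_mul]
      have h5 : inner ℝ v (γ t - u) - ℓ (γ t - u) ≤ ε * ‖γ t - u‖ + κ * ‖γ t - u‖ ^ 2 := by
        linarith
      have h6 := mul_le_mul_of_nonneg_left h5 ht'.le
      linarith
    have hlim : Tendsto (fun ε : ℝ => ε * ‖η‖) (𝓝[>] 0) (𝓝 (0 * ‖η‖)) :=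
      (tendsto_id.mul_const _).mono_left nhdsWithin_le_nhds
    rw [zero_mul] at hlim
    exact ge_of_tendsto hlim (eventually_mem_nhdsWithin.mono fun ε hε => hsmall ε hε)
  obtain ⟨T, hT⟩ := hM.exists_submodule huM
  have h1 := key ξ hξ
  -- Only one inequality holds along a curve; linearity of the tangent space supplies the reverse
  -- one.
  have h2 := key (-ξ) (by rw [hT] at hξ ⊢; exact T.neg_mem hξ)
  rw [inner_neg_right, map_neg] at h2
  linarith

/-- The pairing of a projected subgradient with a tangent vector is a limit of pairings of Fréchet
subgradients with tangent vectors at nearby points of `M`. -/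
lemma exists_seq_of_mem_projSubdifferential {E : Type*} [NormedAddCommGroup E]
    [InnerProductSpace ℝ E] [FiniteDimensional ℝ E] {M : Set E} (hM : IsEmbeddedSubmanifold M)
    {φ : E → ℝ} {x w ξ : E} (hx : x ∈ M)
    (hw : w ∈ projSubdifferential M (fun y => (φ y : EReal)) x) (hξ : ξ ∈ embTangentSpace M x) :
    ∃ u v η : ℕ → E, Tendsto u atTop (𝓝 x) ∧ Tendsto η atTop (𝓝 ξ) ∧
      Tendsto (fun k => inner ℝ (v k) (η k)) atTop (𝓝 (inner ℝ w ξ)) ∧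
      ∀ᶠ k in atTop, u k ∈ M ∧ η k ∈ embTangentSpace M (u k) ∧
        v k ∈ frechetSubdifferential (fun y => (φ y : EReal) + indicatorTop M y) (u k) := by
  obtain ⟨hwT, v₀, ⟨-, -, u, v, hu, -, hv, hlim⟩, hdist⟩ := hw
  obtain ⟨T, hT⟩ := hM.exists_submodule hx
  rw [hT] at hwT hdist
  -- A nearest point in a subspace is the orthogonal projection, so `v₀ - w` is normal to it.
  have horth : inner ℝ v₀ ξ = inner ℝ w ξ := by
    rw [Metric.infDist_eq_iInf] at hdist
    have h := (T.norm_eq_iInf_iff_real_inner_eq_zero hwT).1 (by simpa [dist_eq_norm] using hdist)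
      ξ (by rw [hT] at hξ; exact hξ)
    rwa [inner_sub_left, sub_eq_zero] at h
  obtain ⟨P, hP, hPx, hPT⟩ := hM.exists_continuousAt_tangent hx hξ
  have hη : Tendsto (fun k => P (u k)) atTop (𝓝 ξ) := hPx ▸ hP.tendsto.comp hu
  refine ⟨u, v, fun k => P (u k), hu, hη, horth ▸ hlim.inner hη, ?_⟩
  filter_upwards [hu.eventually hPT] with k hk
  have hkM := (frechetSubdifferential_add_indicator (hv k)).1
  exact ⟨hkM, hk hkM, hv k⟩

/-! ### Uniform second-order error of the retraction. -/

/-- Around each point of `M`, a retraction has a continuous extension and differs from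
`x + ξ` by a uniformly quadratic error. -/
lemma IsRetraction.exists_quadratic_error {E : Type*} [NormedAddCommGroup E]
    [InnerProductSpace ℝ E] [FiniteDimensional ℝ E] {M : Set E} {R : E → E → E}
    (hR : IsRetraction M R) (hM : IsEmbeddedSubmanifold M) {x : E} (hx : x ∈ M) :
    ∃ (K ε : ℝ) (S : E × E → E), 0 ≤ K ∧ 0 < ε ∧
      (∀ u ∈ Metric.ball x ε, ∀ ξ ∈ Metric.ball (0 : E) ε, ContinuousAt S (u, ξ)) ∧
      ∀ u ∈ Metric.ball x ε ∩ M, ∀ ξ ∈ embTangentSpace M u, ‖ξ‖ < ε →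
        S (u, ξ) = R u ξ ∧ ‖R u ξ - u - ξ‖ ≤ K * ‖ξ‖ ^ 2 := by
  have hzero : ∀ u ∈ M, (0 : E) ∈ embTangentSpace M u := fun u hu => by
    obtain ⟨T, hT⟩ := hM.exists_submodule hu
    rw [hT]; exact T.zero_mem
  obtain ⟨W, S, hW, hxW, hS, hSR⟩ := hR.contDiff (x, 0) ⟨hx, hzero x hx⟩
  have hSC : ∀ q ∈ W, ContDiffAt ℝ 2 S q := fun q hq => hS.contDiffAt (hW.mem_nhds hq)
  obtain ⟨K, N, hN, hK⟩ :=
    ((hSC _ hxW).fderiv_right (m := 1) (by norm_num)).exists_lipschitzOnWith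
  obtain ⟨ε, hε, hεs⟩ := Metric.mem_nhds_iff.1 (inter_mem (hW.mem_nhds hxW) hN)
  have hball : ∀ u ∈ Metric.ball x ε, ∀ ξ : E, ‖ξ‖ < ε →
      (u, ξ) ∈ Metric.ball ((x, 0) : E × E) ε := fun u hu ξ hξ => by
    rw [← ball_prod_same]; exact ⟨hu, mem_ball_zero_iff.2 hξ⟩
  refine ⟨K, ε, S, K.2, hε, fun u hu ξ hξ =>
    (hSC _ (hεs (hball u hu ξ (mem_ball_zero_iff.1 hξ))).1).continuousAt, ?_⟩
  rintro u ⟨hu, huM⟩ ξ hξ hξε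
  have hp := hball u hu ξ hξε
  have hp0 := hball u hu 0 (by simpa using hε)
  have hval : S (u, ξ) = R u ξ := hSR (u, ξ) ⟨(hεs hp).1, huM, hξ⟩
  have hval0 : S (u, 0) = u :=
    (hSR (u, 0) ⟨(hεs hp0).1, huM, hzero u huM⟩).trans (hR.map_zero u huM)
  refine ⟨hval, ?_⟩
  have hSd : ∀ q ∈ Metric.ball ((x, 0) : E × E) ε, HasFDerivAt S (fderiv ℝ S q) q := fun q hq =>
    ((hSC q (hεs hq).1).differentiableAt (by norm_num)).hasFDerivAt
  have htaylor := norm_taylor_le_of_lipschitz_fderiv K.2 (convex_ball ((x, 0) : E × E) ε) hSd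
    (fun q hq q' hq' => hK.norm_sub_le (hεs hq).2 (hεs hq').2) hp0 hp
  obtain ⟨T, hT⟩ := hM.exists_submodule huM
  have hsm : ∀ t : ℝ, t • ξ ∈ embTangentSpace M u := fun t => by
    rw [hT] at hξ ⊢; exact T.smul_mem t hξ
  have hline : HasDerivAt (fun t : ℝ => t • ξ) ξ 0 := by
    simpa using (hasDerivAt_id (0 : ℝ)).smul_const ξ
  have hd1 : HasDerivAt (fun t : ℝ => R u (t • ξ)) ξ 0 := by
    have h := (hR.deriv_zero u huM)
    rw [← zero_smul ℝ ξ] at h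
    simpa [Function.comp_def] using (h.comp_hasDerivWithinAt (0 : ℝ) (s := univ) hline.hasDerivWithinAt
      (fun t _ => hsm t)).hasDerivAt univ_mem
  have hd2 : HasDerivAt (fun t : ℝ => S (u, t • ξ)) (fderiv ℝ S (u, 0) (0, ξ)) 0 := by
    have h := hSd _ hp0
    have hl : HasDerivAt (fun t : ℝ => (u, t • ξ)) ((0 : E), ξ) 0 :=
      (hasDerivAt_const (0 : ℝ) u).prodMk hline
    rw [← zero_smul ℝ ξ] at h
    simpa [Function.comp_def] using h.comp_hasDerivAt (0 : ℝ) hl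
  -- The extension `S` is tied to `R` only on the tangent bundle, but the whole line `(u, t • ξ)`
  -- lies there near `t = 0`, which fixes this directional derivative.
  have hDS : fderiv ℝ S (u, 0) (0, ξ) = ξ := by
    refine hd2.unique (hd1.congr_of_eventuallyEq ?_)
    have hev : ∀ᶠ t : ℝ in 𝓝 0, (u, t • ξ) ∈ W := by
      have hc : Continuous fun t : ℝ => (u, t • ξ) := by fun_prop
      refine hc.continuousAt (hW.mem_nhds ?_)
      simpa using (hεs hp0).1
    filter_upwards [hev] with t ht
    exact hSR (u, t • ξ) ⟨ht, huM, hsm t⟩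
  simpa [hval, hval0, hDS] using htaylor

/-! ### Estimate for Fréchet subgradients and passage to the limit. -/

theorem mainTheorem1 {E : Type u} [NormedAddCommGroup E] [InnerProductSpace ℝ E]
    [FiniteDimensional ℝ E] (M O : Set E) (φ : E → ℝ) (R : E → E → E)
    (hM : IsEmbeddedSubmanifold M) (hO : IsOpen O) (hMO : M ⊆ O)
    (hφ : IsUpperC2On.{u, v} φ O) (hR : IsRetraction M R) :
    (∀ xbar ∈ M, ∃ κ > (0 : ℝ), ∃ r > (0 : ℝ), ∃ V : Set E, IsOpen V ∧ xbar ∈ V ∧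
      ∀ x ∈ V ∩ M, ∀ ξ ∈ embTangentSpace M x, ‖ξ‖ ≤ r →
        ∀ w ∈ projSubdifferential M (fun y => (φ y : EReal)) x,
          φ (R x ξ) - (φ x + inner ℝ w ξ) ≤ κ * ‖ξ‖ ^ 2) ∧
    (∀ xbar ∈ M, ∃ G : ℝ, ∃ V : Set E, IsOpen V ∧ xbar ∈ V ∧
      ∀ x ∈ V ∩ M, ∀ w ∈ projSubdifferential M (fun y => (φ y : EReal)) x, ‖w‖ ≤ G) := by
  refine ⟨fun xbar hxbar => ?_, fun xbar hxbar => ?_⟩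
  · obtain ⟨κ, L, ε, hκ, hL, hε, hmodel⟩ := hφ.exists_quadratic_upper_model (hMO hxbar)
    obtain ⟨K, δ, S, hK, hδ, hScont, hRet⟩ := hR.exists_quadratic_error hM hxbar
    -- The radius `2 * r` leaves room for the approximants `η k` of a vector with `‖ξ‖ ≤ r`. The
    -- second condition keeps `R u η` in the ball where the upper model holds.
    have hr : ∃ r > 0, 2 * r < δ ∧ r + 2 * r * (1 + K * (2 * r)) < ε := by
      have hc : Tendsto (fun r : ℝ => r + 2 * r * (1 + K * (2 * r))) (𝓝[>] 0) (𝓝 0) := by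
        have : Continuous fun r : ℝ => r + 2 * r * (1 + K * (2 * r)) := by fun_prop
        exact (by simpa using this.tendsto 0 : Tendsto _ _ (𝓝 (0 : ℝ))).mono_left
          nhdsWithin_le_nhds
      obtain ⟨r, h1, h2, h3⟩ := (eventually_mem_nhdsWithin.and ((hc.eventually (gt_mem_nhds hε)).and
        (nhdsWithin_le_nhds (gt_mem_nhds (half_pos hδ))))).exists
      exact ⟨r, h1, by linarith, h2⟩
    obtain ⟨r, hr, hrδ, hrε⟩ := hr
    have hrr : 0 ≤ 2 * r * (1 + K * (2 * r)) := by positivity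
    have hfrechet : ∀ u ∈ Metric.ball xbar r ∩ M, ∀ η ∈ embTangentSpace M u, ‖η‖ < 2 * r →
        ∀ v ∈ frechetSubdifferential (fun y => (φ y : EReal) + indicatorTop M y) u,
        φ (R u η) ≤ φ u + inner ℝ v η + (L * K + κ * (1 + K * (2 * r)) ^ 2) * ‖η‖ ^ 2 := by
      rintro u ⟨hu, huM⟩ η hη hηr v hv
      have huε : u ∈ Metric.ball xbar ε := Metric.ball_subset_ball (by linarith) hu
      obtain ⟨ℓ, hℓ, hup⟩ := hmodel u huε
      have hin := inner_eq_of_mem_frechetSubdifferential hM hv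
        (Filter.mem_of_superset (Metric.isOpen_ball.mem_nhds huε) hup) hη
      obtain ⟨-, herr⟩ := hRet u ⟨Metric.ball_subset_ball (by linarith) hu, huM⟩ η hη
        (by linarith)
      have hnorm : ‖R u η - u‖ ≤ (1 + K * (2 * r)) * ‖η‖ := by
        calc ‖R u η - u‖ = ‖(R u η - u - η) + η‖ := by rw [sub_add_cancel]
          _ ≤ K * ‖η‖ ^ 2 + ‖η‖ := (norm_add_le _ _).trans (by gcongr)
          _ = K * ‖η‖ * ‖η‖ + ‖η‖ := by ring
          _ ≤ K * (2 * r) * ‖η‖ + ‖η‖ := by gcongr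
          _ = _ := by ring
      have hmem : R u η ∈ Metric.ball xbar ε := by
        rw [mem_ball_iff_norm] at hu ⊢
        have h1 : (1 + K * (2 * r)) * ‖η‖ ≤ (1 + K * (2 * r)) * (2 * r) := by gcongr
        have h2 : ‖R u η - xbar‖ ≤ ‖R u η - u‖ + ‖u - xbar‖ := norm_sub_le_norm_sub_add_norm_sub ..
        linarith
      have h1 := hup _ hmem
      have h2 : ℓ (R u η - u) ≤ ℓ η + L * (K * ‖η‖ ^ 2) := by
        have h3 : ℓ (R u η - u - η) ≤ L * (K * ‖η‖ ^ 2) :=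
          (Real.le_norm_self _).trans ((ℓ.le_of_opNorm_le hℓ _).trans (by gcongr))
        rw [map_sub] at h3
        linarith
      have h3 : κ * ‖R u η - u‖ ^ 2 ≤ κ * ((1 + K * (2 * r)) * ‖η‖) ^ 2 := by gcongr
      rw [hin]
      linarith
    -- `L * K` bounds `ℓ` on the retraction error, the next term is the quadratic part of the model,
    -- and `+ 1` only ensures positivity.
    refine ⟨L * K + κ * (1 + K * (2 * r)) ^ 2 + 1, by positivity, r, hr, Metric.ball xbar r,
      Metric.isOpen_ball, Metric.mem_ball_self hr, ?_⟩
    rintro x ⟨hx, hxM⟩ ξ hξ hξr w hw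
    obtain ⟨u, v, η, hu, hη, hvη, hev⟩ := exists_seq_of_mem_projSubdifferential hM hxM hw hξ
    have hxδ : x ∈ Metric.ball xbar δ := Metric.ball_subset_ball (by linarith) hx
    have hSx : S (x, ξ) = R x ξ := (hRet x ⟨hxδ, hxM⟩ ξ hξ (by linarith)).1
    have hRlim : Tendsto (fun k => R (u k) (η k)) atTop (𝓝 (R x ξ)) := by
      have h1 : Tendsto (fun k => S (u k, η k)) atTop (𝓝 (S (x, ξ))) :=
        (hScont x hxδ ξ (mem_ball_zero_iff.2 (by linarith))).tendsto.comp (hu.prodMk_nhds hη)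
      rw [hSx] at h1
      refine h1.congr' ?_
      filter_upwards [hev, hu (Metric.isOpen_ball.mem_nhds hxδ),
        hη.norm (gt_mem_nhds (by linarith : ‖ξ‖ < δ))] with k hk hkδ hηδ
      exact (hRet (u k) ⟨hkδ, hk.1⟩ (η k) hk.2.1 hηδ).1
    have hlim := le_of_tendsto_of_tendsto
      ((hφ.continuousAt (hMO (hR.mapsTo x hxM ξ hξ))).tendsto.comp hRlim)
      ((((hφ.continuousAt (hMO hxM)).tendsto.comp hu).add hvη).add
        ((hη.norm.pow 2).const_mul (L * K + κ * (1 + K * (2 * r)) ^ 2))) (by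
        filter_upwards [hev, hu (Metric.isOpen_ball.mem_nhds hx),
          hη.norm (gt_mem_nhds (by linarith : ‖ξ‖ < 2 * r))] with k hk hkr hηr
        exact hfrechet (u k) ⟨hkr, hk.1⟩ (η k) hk.2.1 hηr (v k) hk.2.2)
    nlinarith [sq_nonneg ‖ξ‖]
  · obtain ⟨κ, L, ε, hκ, hL, hε, hmodel⟩ := hφ.exists_quadratic_upper_model (hMO hxbar)
    refine ⟨L, Metric.ball xbar ε, Metric.isOpen_ball, Metric.mem_ball_self hε, ?_⟩
    rintro x ⟨hx, hxM⟩ w hw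
    -- `w` is itself tangent, so it can serve as the test direction.
    obtain ⟨u, v, η, hu, hη, hvη, hev⟩ := exists_seq_of_mem_projSubdifferential hM hxM hw hw.1
    have hle : inner ℝ w w ≤ L * ‖w‖ := by
      refine le_of_tendsto_of_tendsto hvη (hη.norm.const_mul L) ?_
      filter_upwards [hev, hu (Metric.isOpen_ball.mem_nhds hx)] with k hk hkε
      obtain ⟨ℓ, hℓ, hup⟩ := hmodel (u k) hkε
      rw [inner_eq_of_mem_frechetSubdifferential hM hk.2.2
        (Filter.mem_of_superset (Metric.isOpen_ball.mem_nhds hkε) hup) hk.2.1]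
      exact (Real.le_norm_self _).trans (ℓ.le_of_opNorm_le hℓ _)
    rw [real_inner_self_eq_norm_sq, pow_two] at hle
    by_contra! hlt
    exact absurd (le_of_mul_le_mul_right hle (hL.trans_lt hlt)) (not_le.2 hlt)
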